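/- Let $A\in\mathbb C^{3\times 3}$, with $\|\cdot\|$ the operator norm induced by the Euclidean norm on $\mathbb C^3$, and suppose that the numerical range $W(A)=\{\langle Ax,x\rangle : x\in\mathbb C^3,\ \|x\|=1\}$ is a circular disk $\{z\in\mathbb C : |z-c|\le r\}$ with centre $c\in\mathbb C$ and radius $r\ge 0$ (the degenerate case $r=0$ is allowed). Recall that $A$ is Roberts orthogonal to $I$, written $A\perp_R I$, if $\|A+\nu I\|=\|A-\nu I\|$ for all $\nu\in\mathbb C$, and that the Stampfli point $\operatorname{St}(A)$ is the unique $\lambda\in\mathbb C$ at which $\|A-\lambda I\|$ attains its minimum. Then: 1. $A\perp_R I$ if and only if $A$ is nilpotent or $A$ is unitarily similar to a direct sum of a $1\times 1$ block and a nilpotent $2\times 2$ block. 2. $A\perp_R I$ if and only if $c=0$ and $\operatorname{St}(A)=0$. -/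

import Mathlib

open scoped Matrix.Norms.L2Operator

/-- Roberts orthogonality in a normed space over `𝕜`: `‖x + ν y‖ = ‖x - ν y‖` for all scalars `ν`. -/
def RobertsOrthogonal (𝕜 : Type*) {X : Type*} [NormedField 𝕜] [NormedAddCommGroup X]
    [NormedSpace 𝕜 X] (x y : X) : Prop :=
  ∀ ν : 𝕜, ‖x + ν • y‖ = ‖x - ν • y‖

namespace Matrix

/-- The numerical range `W(A) = {⟨A x, x⟩ : ‖x‖ = 1}` of a complex square matrix, with the Euclidean
norm and inner product (Mathlib's `inner` is linear in its second argument). -/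
def numRange {n : Type*} [Fintype n] [DecidableEq n] (A : Matrix n n ℂ) : Set ℂ :=
  {z | ∃ x : EuclideanSpace ℂ n, ‖x‖ = 1 ∧ inner ℂ x (Matrix.toEuclideanCLM (𝕜 := ℂ) A x) = z}

/-- `μ ↦ ‖A - μ I‖` (operator norm induced by the Euclidean norm) attains its minimum at `w`. -/
def IsCenterOfMass {n : Type*} [Fintype n] [DecidableEq n] (A : Matrix n n ℂ) (w : ℂ) : Prop :=
  ∀ μ : ℂ, ‖A - w • (1 : Matrix n n ℂ)‖ ≤ ‖A - μ • (1 : Matrix n n ℂ)‖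

theorem exists_isCenterOfMass {n : Type*} [Fintype n] [DecidableEq n] [Nonempty n]
    (A : Matrix n n ℂ) : ∃ w, IsCenterOfMass A w := by
  have hc : Continuous fun μ : ℂ => ‖A - μ • (1 : Matrix n n ℂ)‖ := by fun_prop
  have h1 : 0 < ‖(1 : Matrix n n ℂ)‖ := norm_pos_iff.2 one_ne_zero
  obtain ⟨w, hw⟩ := hc.exists_forall_le (by
    refine Filter.tendsto_atTop_mono (f := fun μ : ℂ => ‖μ‖ * ‖(1 : Matrix n n ℂ)‖ - ‖A‖) ?_ ?_
    · intro μ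
      have := norm_sub_norm_le (μ • (1 : Matrix n n ℂ)) A
      rw [norm_smul, norm_sub_rev] at this
      exact this
    · exact Filter.tendsto_atTop_add_const_right _ _
        ((tendsto_norm_cocompact_atTop (E := ℂ)).atTop_mul_const h1))
  exact ⟨w, hw⟩

theorem IsCenterOfMass.unique {n : Type*} [Fintype n] [DecidableEq n] [Nonempty n]
    {A : Matrix n n ℂ} {v w : ℂ} (hv : IsCenterOfMass A v) (hw : IsCenterOfMass A w) : v = w := by
  set m := ‖A - v • (1 : Matrix n n ℂ)‖ with hm
  have hmw : ‖A - w • (1 : Matrix n n ℂ)‖ = m := le_antisymm (hw v) (hv w)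
  set T := Matrix.toEuclideanCLM (n := n) (𝕜 := ℂ) with hT
  have key : ∀ (μ : ℂ) (x : EuclideanSpace ℂ n), T (A - μ • (1 : Matrix n n ℂ)) x = T A x - μ • x := by
    intro μ x
    rw [map_sub, map_smul, map_one]; rfl
  have hb : ∀ (μ : ℂ) (x : EuclideanSpace ℂ n),
      ‖T A x - μ • x‖ ≤ ‖A - μ • (1 : Matrix n n ℂ)‖ * ‖x‖ := by
    intro μ x
    rw [← key, Matrix.l2_opNorm_def]
    exact ContinuousLinearMap.le_opNorm _ x
  set d : ℝ := ‖(v - w) / 2‖ with hd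
  have hmid : ‖A - ((v + w) / 2) • (1 : Matrix n n ℂ)‖ ≤ √(m ^ 2 - d ^ 2) := by
    rw [Matrix.l2_opNorm_def]
    refine ContinuousLinearMap.opNorm_le_bound _ (Real.sqrt_nonneg _) fun x => ?_
    change ‖T (A - ((v + w) / 2) • (1 : Matrix n n ℂ)) x‖ ≤ _
    rw [key]
    have p := parallelogram_law_with_norm ℂ (T A x - ((v + w) / 2) • x) (((v - w) / 2) • x)
    have e1 : T A x - ((v + w) / 2) • x + ((v - w) / 2) • x = T A x - w • x := by module
    have e2 : T A x - ((v + w) / 2) • x - ((v - w) / 2) • x = T A x - v • x := by module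
    rw [e1, e2, norm_smul, ← hd] at p
    have b1 := hb w x
    have b2 := hb v x
    rw [hmw] at b1
    rw [← hm] at b2
    have c1 := mul_self_le_mul_self (norm_nonneg _) b1
    have c2 := mul_self_le_mul_self (norm_nonneg _) b2
    rw [← Real.sqrt_sq (norm_nonneg x), ← Real.sqrt_mul' _ (sq_nonneg _)]
    apply Real.le_sqrt_of_sq_le
    nlinarith
  have h0 := (hv ((v + w) / 2)).trans hmid
  rw [← hm] at h0
  have hmd : d ^ 2 ≤ 0 := by
    by_contra hlt
    push Not at hlt
    rcases le_or_gt 0 (m ^ 2 - d ^ 2) with h | h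
    · have := (Real.le_sqrt (norm_nonneg _) h).1 h0
      rw [← hm] at this
      linarith
    · rw [Real.sqrt_eq_zero_of_nonpos h.le] at h0
      have hm0 : m = 0 := le_antisymm h0 (norm_nonneg _)
      have h2 : ‖(v - w) • (1 : Matrix n n ℂ)‖ ≤ 0 := by
        have : (v - w) • (1 : Matrix n n ℂ)
            = (A - w • (1 : Matrix n n ℂ)) - (A - v • (1 : Matrix n n ℂ)) := by module
        rw [this]
        refine (norm_sub_le _ _).trans ?_
        rw [hmw, ← hm, hm0]; simp
      have h3 := norm_le_zero_iff.1 h2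
      have h4 : v - w = 0 := (smul_eq_zero.1 h3).resolve_right one_ne_zero
      rw [hd, h4] at hlt
      simp at hlt
  have hd0 : d = 0 := by nlinarith [sq_nonneg d]
  rw [hd, norm_eq_zero] at hd0
  have : v - w = 0 := by simpa using hd0
  exact sub_eq_zero.1 this

/-- The Stampfli point (center of mass) `St(A)`: the unique `w` at which `‖A - w I‖` is minimal. -/
noncomputable def stampfliPoint {n : Type*} [Fintype n] [DecidableEq n] [Nonempty n]
    (A : Matrix n n ℂ) : ℂ :=
  (exists_isCenterOfMass A).choose

theorem stampfliPoint_eq_iff {n : Type*} [Fintype n] [DecidableEq n] [Nonempty n]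
    (A : Matrix n n ℂ) (w : ℂ) : stampfliPoint A = w ↔ IsCenterOfMass A w :=
  ⟨fun h => h ▸ (exists_isCenterOfMass A).choose_spec,
    fun h => (exists_isCenterOfMass A).choose_spec.unique h⟩

/-- Unitary similarity of complex square matrices. -/
def UnitarilySimilar {n : Type*} [Fintype n] [DecidableEq n] (A B : Matrix n n ℂ) : Prop :=
  ∃ U ∈ Matrix.unitaryGroup n ℂ, A = U * B * star U

/-- The block diagonal matrix `P ⊕ Q`. -/
def dirSum {k l : ℕ} (P : Matrix (Fin k) (Fin k) ℂ) (Q : Matrix (Fin l) (Fin l) ℂ) :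
    Matrix (Fin (k + l)) (Fin (k + l)) ℂ :=
  Matrix.reindex finSumFinEquiv finSumFinEquiv (Matrix.fromBlocks P 0 0 Q)

end Matrix

/-!
Write `B = A - c` and let `W(A)` be the disk of centre `c` and radius `r > 0`. Every support line of
the disk touches it, so `2r` is an eigenvalue of `ū B + u Bᴴ` for every `u` on the unit circle and
the polynomial `det (2 r u - B - u² Bᴴ)` in `u` vanishes identically (`det_eq_zero_of_numRange`).
Its two lowest coefficients say that `0` is at least a double eigenvalue of `B`
(`det_and_minors_eq_zero`), so `B` is unitarily similar to a triangular matrix with diagonal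
`0, 0, a` and entries `x, y, z` above it; the next coefficients give
`a (|y|² + |z|²) = -x y z̄` (`exists_triangular_form_of_numRange`).

Three implications are proved in a cycle.

* If `A` is Roberts orthogonal to `I`, convexity of the norm makes `0` the minimizer of `‖A - μ‖`,
  and the behaviour of `‖A - ν‖` for large `ν`, which detects the support function of `W(A)`, forces
  `c = 0` (`center_eq_zero_of_robertsOrthogonal`).
* If `c = 0` and `St(A) = 0`, first-order optimality at `0`
  (`ContinuousLinearMap.exists_norm_apply_eq_and_re_inner_nonpos`) is played against the triangular
  form: unless `a = 0` or `y = z = 0`, the maximizing vector of `A` is unique up to a scalar, satisfies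
  `⟨A v, v⟩ = 0`, and its eigenvector equations then give `y = 0`, a contradiction
  (`eq_zero_or_of_isCenterOfMass`). If `a = 0` the matrix is nilpotent, and if `y = z = 0` it is the
  required direct sum.
* Conversely, comparing eigenvalues shows that both forms have `c = 0`. In the nilpotent case
  `x y z = 0`, and a diagonal matrix of signs conjugates `A` to `-A`. In the other case the
  `1 × 1` block `a` lies in the disk, so `|a + ν| ≤ r + |ν| ≤ ‖A - ν‖`: this block never
  determines the norm, and the `2 × 2` block is again unitarily similar to its negative.

For `r = 0` the matrix is `c I`, and everything reduces to `c = 0`.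
-/

open scoped ComplexConjugate

namespace Matrix

/-! ### Unitary similarity -/

section UnitarySimilarity

variable {n : Type*} [Fintype n] [DecidableEq n]

theorem norm_unitary_conj {U : Matrix n n ℂ} (hU : U ∈ unitaryGroup n ℂ) (B : Matrix n n ℂ) :
    ‖U * B * star U‖ = ‖B‖ := by
  rw [CStarRing.norm_mul_mem_unitary _ (Unitary.star_mem hU), CStarRing.norm_mem_unitary_mul _ hU]

theorem unitary_conj_add_smul_one {U : Matrix n n ℂ} (hU : U ∈ unitaryGroup n ℂ)
    (B : Matrix n n ℂ) (t : ℂ) : U * (B + t • 1) * star U = U * B * star U + t • 1 := by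
  rw [mul_add, add_mul, mul_smul_comm, mul_one, smul_mul_assoc, mem_unitaryGroup_iff.1 hU]

theorem trace_unitary_conj {U : Matrix n n ℂ} (hU : U ∈ unitaryGroup n ℂ) (B : Matrix n n ℂ) :
    (U * B * star U).trace = B.trace := by
  rw [trace_mul_cycle, mem_unitaryGroup_iff'.1 hU, one_mul]

theorem det_unitary_conj {U : Matrix n n ℂ} (hU : U ∈ unitaryGroup n ℂ) (B : Matrix n n ℂ) :
    (U * B * star U).det = B.det := by
  rw [det_mul, det_mul, mul_right_comm, ← det_mul, mem_unitaryGroup_iff.1 hU, det_one, one_mul]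

theorem unitary_conj_mul {U : Matrix n n ℂ} (hU : U ∈ unitaryGroup n ℂ) (B C : Matrix n n ℂ) :
    (U * B * star U) * (U * C * star U) = U * (B * C) * star U := by
  have h := mem_unitaryGroup_iff'.1 hU
  calc _ = U * B * (star U * U) * C * star U := by simp only [mul_assoc]
    _ = _ := by rw [h]; simp only [mul_one, mul_assoc]

theorem unitary_conj_eq_iff {U : Matrix n n ℂ} (hU : U ∈ unitaryGroup n ℂ) {A B : Matrix n n ℂ} :
    A = U * B * star U ↔ star U * A * U = B := by
  have h := mem_unitaryGroup_iff'.1 hU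
  have h' := mem_unitaryGroup_iff.1 hU
  constructor
  · rintro rfl
    calc _ = (star U * U) * B * (star U * U) := by simp only [mul_assoc]
      _ = B := by rw [h, one_mul, mul_one]
  · rintro rfl
    calc A = (U * star U) * A * (U * star U) := by rw [h', one_mul, mul_one]
      _ = _ := by simp only [mul_assoc]

theorem isNilpotent_unitary_conj {U : Matrix n n ℂ} (hU : U ∈ unitaryGroup n ℂ)
    {B : Matrix n n ℂ} : IsNilpotent (U * B * star U) ↔ IsNilpotent B := by
  have hp : ∀ k : ℕ, (U * B * star U) ^ (k + 1) = U * B ^ (k + 1) * star U := by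
    intro k
    induction k with
    | zero => simp
    | succ k ih => rw [pow_succ, ih, unitary_conj_mul hU, ← pow_succ]
  constructor
  · rintro ⟨k, hk⟩
    refine ⟨k + 1, ?_⟩
    have h := hp k
    rw [pow_succ, hk, zero_mul] at h
    have := (unitary_conj_eq_iff hU).1 h
    rw [← this]; simp
  · rintro ⟨k, hk⟩
    refine ⟨k + 1, ?_⟩
    rw [hp, pow_succ, hk]; simp

theorem UnitarilySimilar.symm {A B : Matrix n n ℂ} (h : UnitarilySimilar A B) :
    UnitarilySimilar B A := by
  obtain ⟨U, hU, rfl⟩ := h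
  refine ⟨star U, Unitary.star_mem hU, ?_⟩
  rw [star_star, (unitary_conj_eq_iff hU).1 rfl]

theorem UnitarilySimilar.trans {A B C : Matrix n n ℂ} (h : UnitarilySimilar A B)
    (h' : UnitarilySimilar B C) : UnitarilySimilar A C := by
  obtain ⟨U, hU, rfl⟩ := h
  obtain ⟨V, hV, rfl⟩ := h'
  exact ⟨U * V, mul_mem hU hV, by simp only [star_mul, mul_assoc]⟩

theorem UnitarilySimilar.norm_add_smul_one {A B : Matrix n n ℂ} (h : UnitarilySimilar A B)
    (t : ℂ) : ‖A + t • (1 : Matrix n n ℂ)‖ = ‖B + t • (1 : Matrix n n ℂ)‖ := by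
  obtain ⟨U, hU, rfl⟩ := h
  rw [← unitary_conj_add_smul_one hU, norm_unitary_conj hU]

theorem UnitarilySimilar.norm_sub_smul_one {A B : Matrix n n ℂ} (h : UnitarilySimilar A B)
    (t : ℂ) : ‖A - t • (1 : Matrix n n ℂ)‖ = ‖B - t • (1 : Matrix n n ℂ)‖ := by
  simpa [sub_eq_add_neg] using h.norm_add_smul_one (-t)

theorem UnitarilySimilar.isCenterOfMass_iff {A B : Matrix n n ℂ} (h : UnitarilySimilar A B)
    (w : ℂ) : IsCenterOfMass A w ↔ IsCenterOfMass B w := by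
  simp only [IsCenterOfMass, h.norm_sub_smul_one]

theorem UnitarilySimilar.robertsOrthogonal_iff {A B : Matrix n n ℂ} (h : UnitarilySimilar A B) :
    RobertsOrthogonal ℂ A (1 : Matrix n n ℂ) ↔ RobertsOrthogonal ℂ B (1 : Matrix n n ℂ) := by
  simp only [RobertsOrthogonal, h.norm_sub_smul_one, h.norm_add_smul_one]

theorem UnitarilySimilar.isNilpotent_iff {A B : Matrix n n ℂ} (h : UnitarilySimilar A B) :
    IsNilpotent A ↔ IsNilpotent B := by
  obtain ⟨U, hU, rfl⟩ := h
  exact isNilpotent_unitary_conj hU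

end UnitarySimilarity

/-! ### Numerical range equal to a disk -/

section Disk

variable {n : Type*} [Fintype n] [DecidableEq n]

theorem inner_toEuclideanCLM_sub_smul_one (A : Matrix n n ℂ) (c : ℂ) (x : EuclideanSpace ℂ n) :
    inner ℂ x (toEuclideanCLM (𝕜 := ℂ) (A - c • 1) x)
      = inner ℂ x (toEuclideanCLM (𝕜 := ℂ) A x) - c * ‖x‖ ^ 2 := by
  rw [map_sub, map_smul, map_one, _root_.sub_apply, inner_sub_right,
    _root_.smul_apply, inner_smul_right, one_apply_eq_self,
    inner_self_eq_norm_sq_to_K]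
  rfl

theorem norm_inner_le_of_numRange {A : Matrix n n ℂ} {c : ℂ} {r : ℝ}
    (hW : numRange A = Metric.closedBall c r) (x : EuclideanSpace ℂ n) :
    ‖inner ℂ x (toEuclideanCLM (𝕜 := ℂ) (A - c • 1) x)‖ ≤ r * ‖x‖ ^ 2 := by
  rcases eq_or_ne x 0 with rfl | hx
  · simp
  have hx' : (‖x‖ : ℂ) ≠ 0 := by simpa using hx
  set y : EuclideanSpace ℂ n := (‖x‖ : ℂ)⁻¹ • x with hy
  have hy1 : ‖y‖ = 1 := by
    rw [hy, norm_smul, norm_inv, Complex.norm_real, norm_norm, inv_mul_cancel₀ (by simpa using hx)]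
  have hmem : inner ℂ y (toEuclideanCLM (𝕜 := ℂ) A y) ∈ numRange A := ⟨y, hy1, rfl⟩
  rw [hW, mem_closedBall_iff_norm] at hmem
  have hxy : x = (‖x‖ : ℂ) • y := by rw [hy, smul_smul, mul_inv_cancel₀ hx', one_smul]
  have e : inner ℂ y (toEuclideanCLM (𝕜 := ℂ) A y) - c
      = inner ℂ y (toEuclideanCLM (𝕜 := ℂ) (A - c • 1) y) := by
    rw [inner_toEuclideanCLM_sub_smul_one, hy1]; simp
  rw [e] at hmem
  have e2 : inner ℂ x (toEuclideanCLM (𝕜 := ℂ) (A - c • 1) x)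
      = (‖x‖ : ℂ) ^ 2 * inner ℂ y (toEuclideanCLM (𝕜 := ℂ) (A - c • 1) y) := by
    conv_lhs => rw [hxy]
    rw [map_smul, inner_smul_left, inner_smul_right, Complex.conj_ofReal]
    ring
  rw [e2, norm_mul, norm_pow, Complex.norm_real, norm_norm, mul_comm]
  gcongr

theorem exists_inner_eq_of_numRange {A : Matrix n n ℂ} {c : ℂ} {r : ℝ} (hr : 0 ≤ r)
    (hW : numRange A = Metric.closedBall c r) {u : ℂ} (hu : ‖u‖ ≤ 1) :
    ∃ x : EuclideanSpace ℂ n, ‖x‖ = 1 ∧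
      inner ℂ x (toEuclideanCLM (𝕜 := ℂ) (A - c • 1) x) = r * u := by
  have : c + r * u ∈ numRange A := by
    rw [hW, mem_closedBall_iff_norm, add_sub_cancel_left, norm_mul, Complex.norm_real,
      Real.norm_of_nonneg hr]
    exact mul_le_of_le_one_right hr hu
  obtain ⟨x, hx, h⟩ := this
  refine ⟨x, hx, ?_⟩
  rw [inner_toEuclideanCLM_sub_smul_one, h, hx]; simp

theorem star_dotProduct_mulVec_eq_inner (M : Matrix n n ℂ) (x : EuclideanSpace ℂ n) :
    star (WithLp.ofLp x) ⬝ᵥ M *ᵥ (WithLp.ofLp x) = inner ℂ x (toEuclideanCLM (𝕜 := ℂ) M x) := by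
  rw [EuclideanSpace.inner_eq_star_dotProduct, ofLp_toEuclideanCLM, dotProduct_comm]

theorem inner_conjTranspose (M : Matrix n n ℂ) (x y : EuclideanSpace ℂ n) :
    inner ℂ x (toEuclideanCLM (𝕜 := ℂ) Mᴴ y) = inner ℂ (toEuclideanCLM (𝕜 := ℂ) M x) y := by
  rw [← star_eq_conjTranspose, map_star, ContinuousLinearMap.star_eq_adjoint,
    ContinuousLinearMap.adjoint_inner_right]

open scoped ComplexOrder in
/-- The support line of the disk in the direction `u` touches the numerical range, so `2r` is the
largest eigenvalue of `ū B + u Bᴴ` with `B = A - c`. -/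
theorem det_eq_zero_of_numRange {A : Matrix n n ℂ} {c : ℂ} {r : ℝ} (hr : 0 ≤ r)
    (hW : numRange A = Metric.closedBall c r) {u : ℂ} (hu : ‖u‖ = 1) :
    ((2 * r * u) • (1 : Matrix n n ℂ) - (A - c • 1) - u ^ 2 • (A - c • 1)ᴴ).det = 0 := by
  set B := A - c • (1 : Matrix n n ℂ) with hB
  set M : Matrix n n ℂ := (2 * r : ℂ) • 1 - conj u • B - u • Bᴴ with hM
  have huu : u * conj u = 1 := by rw [Complex.mul_conj, Complex.normSq_eq_norm_sq, hu]; simp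
  have hform : ∀ x : EuclideanSpace ℂ n, inner ℂ x (toEuclideanCLM (𝕜 := ℂ) M x)
      = ((2 * (r * ‖x‖ ^ 2 - (conj u * inner ℂ x (toEuclideanCLM (𝕜 := ℂ) B x)).re) : ℝ) : ℂ) := by
    intro x
    have h1 : inner ℂ x (toEuclideanCLM (𝕜 := ℂ) Bᴴ x)
        = conj (inner ℂ x (toEuclideanCLM (𝕜 := ℂ) B x)) := by
      rw [inner_conjTranspose, inner_conj_symm]
    have h2 := Complex.add_conj (conj u * inner ℂ x (toEuclideanCLM (𝕜 := ℂ) B x))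
    rw [map_mul, Complex.conj_conj] at h2
    rw [hM, map_sub, map_sub, map_smul, map_smul, map_smul, map_one]
    simp only [_root_.sub_apply, inner_sub_right, _root_.smul_apply,
      inner_smul_right, one_apply_eq_self, inner_self_eq_norm_sq_to_K, h1]
    push_cast at h2 ⊢
    simp only [Complex.coe_algebraMap]
    linear_combination -h2
  have hpos : M.PosSemidef := by
    refine PosSemidef.of_dotProduct_mulVec_nonneg ?_ fun x => ?_
    · simp only [IsHermitian, hM, conjTranspose_sub, conjTranspose_smul, conjTranspose_one,
        conjTranspose_conjTranspose]
      simp only [Complex.star_def, Complex.conj_conj, map_mul, map_ofNat, Complex.conj_ofReal]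
      abel
    · have := star_dotProduct_mulVec_eq_inner M (WithLp.toLp 2 x)
      simp only at this
      rw [this, hform, Complex.zero_le_real]
      have h1 := norm_inner_le_of_numRange hW (WithLp.toLp 2 x)
      have h2 := Complex.re_le_norm
        (conj u * inner ℂ (WithLp.toLp 2 x) (toEuclideanCLM (𝕜 := ℂ) B (WithLp.toLp 2 x)))
      rw [norm_mul, RCLike.norm_conj, hu, one_mul] at h2
      linarith
  obtain ⟨x, hx, hxu⟩ := exists_inner_eq_of_numRange hr hW hu.le
  rw [← hB] at hxu
  have hx0 : star (WithLp.ofLp x) ⬝ᵥ M *ᵥ (WithLp.ofLp x) = 0 := by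
    rw [star_dotProduct_mulVec_eq_inner, hform, hxu, hx]
    have : conj u * (r * u) = (r : ℂ) := by linear_combination (r : ℂ) * huu
    rw [this]; simp
  have hker := (hpos.dotProduct_mulVec_zero_iff _).1 hx0
  have hdet : M.det = 0 := exists_mulVec_eq_zero_iff.1 ⟨WithLp.ofLp x, by
    rintro h
    have : x = 0 := by ext i; simp [h]
    rw [this] at hx; simp at hx, hker⟩
  have : (2 * r * u) • (1 : Matrix n n ℂ) - B - u ^ 2 • Bᴴ = u • M := by
    rw [hM, smul_sub, smul_sub, smul_smul, smul_smul, smul_smul, huu, one_smul]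
    ring_nf
  rw [this, det_smul, hdet, mul_zero]

end Disk

/-! ### Triangular form -/

section Triangular

theorem exists_unitary_col_zero {m : ℕ} [NeZero m] {v : Fin m → ℂ} (hv : v ≠ 0) :
    ∃ U ∈ unitaryGroup (Fin m) ℂ, ∃ k : ℂ, ∀ i, U i 0 = k * v i := by
  set w : EuclideanSpace ℂ (Fin m) := WithLp.toLp 2 v with hw
  have hw0 : w ≠ 0 := by
    intro h
    exact hv (by simpa [hw] using h)
  set e : Fin m → EuclideanSpace ℂ (Fin m) := fun _ => (‖w‖ : ℂ)⁻¹ • w with he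
  have hon : Orthonormal ℂ (({0} : Set (Fin m)).domRestrict e) := by
    constructor
    · intro i
      simp [he, Set.domRestrict, norm_smul, hw0]
    · intro i j hij
      exact absurd (Subsingleton.elim i j) hij
  obtain ⟨b, hb⟩ := hon.exists_orthonormalBasis_extension_of_card_eq (by simp)
  refine ⟨(EuclideanSpace.basisFun _ ℂ).toBasis.toMatrix b.toBasis, ?_, (‖w‖ : ℂ)⁻¹, fun i => ?_⟩
  · simpa using (EuclideanSpace.basisFun _ ℂ).toMatrix_orthonormalBasis_mem_unitary b
  · simp [Module.Basis.toMatrix_apply, hb 0 (by simp), he, hw]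

theorem exists_unitarilySimilar_col_zero {m : ℕ} [NeZero m] {B : Matrix (Fin m) (Fin m) ℂ}
    (hB : B.det = 0) : ∃ C, UnitarilySimilar B C ∧ ∀ i, C i 0 = 0 := by
  obtain ⟨v, hv, hBv⟩ := exists_mulVec_eq_zero_iff.2 hB
  obtain ⟨U, hU, k, hk⟩ := exists_unitary_col_zero hv
  refine ⟨star U * B * U, ⟨U, hU, (unitary_conj_eq_iff hU).2 rfl⟩, fun i => ?_⟩
  have h : ∀ j, (B * U) j 0 = 0 := by
    intro j
    have := congrFun hBv j
    simp only [mulVec, dotProduct, Pi.zero_apply] at this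
    simp only [mul_apply, hk]
    calc _ = k * ∑ x, B j x * v x := by rw [Finset.mul_sum]; congr 1; ext x; ring
      _ = 0 := by rw [this, mul_zero]
  rw [mul_assoc, mul_apply]
  simp [h]

/-- The hypothesis on the traces says that the sum of the principal `2 × 2` minors,
`(tr(B)² - tr(B²)) / 2`, vanishes. Together with the determinant it vanishes exactly when
`0` is at least a double eigenvalue; then the two zeros can be put first on the diagonal. -/
theorem exists_unitarilySimilar_upperTriangular {B : Matrix (Fin 3) (Fin 3) ℂ} (h0 : B.det = 0)
    (h1 : B.trace ^ 2 = (B * B).trace) :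
    ∃ x y z a : ℂ, UnitarilySimilar B !![0, x, z; 0, 0, y; 0, 0, a] := by
  obtain ⟨C, hBC, hC⟩ := exists_unitarilySimilar_col_zero h0
  have hC1 : C.trace ^ 2 = (C * C).trace := by
    obtain ⟨U, hU, rfl⟩ := hBC
    rwa [unitary_conj_mul hU, trace_unitary_conj hU, trace_unitary_conj hU] at h1
  simp only [trace_fin_three, mul_apply, Fin.sum_univ_three, hC] at hC1
  -- deflation: the lower right block is again singular, which gives the second kernel vector
  set D : Matrix (Fin 2) (Fin 2) ℂ := !![C 1 1, C 1 2; C 2 1, C 2 2] with hD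
  have hdet : D.det = 0 := by
    rw [hD, det_fin_two_of]; linear_combination hC1 / 2
  obtain ⟨E, ⟨V, hV, hDE⟩, hE⟩ := exists_unitarilySimilar_col_zero hdet
  set W : Matrix (Fin 3) (Fin 3) ℂ := !![1, 0, 0; 0, V 0 0, V 0 1; 0, V 1 0, V 1 1] with hWdef
  have hW : W ∈ unitaryGroup (Fin 3) ℂ := by
    rw [mem_unitaryGroup_iff] at hV ⊢
    have e : ∀ i j, (V * star V) i j = (1 : Matrix (Fin 2) (Fin 2) ℂ) i j := by simp [hV]
    simp only [mul_apply, Fin.sum_univ_two, star_apply] at e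
    have e00 := e 0 0
    have e01 := e 0 1
    have e10 := e 1 0
    have e11 := e 1 1
    ext i j
    fin_cases i <;> fin_cases j <;>
      simp_all [mul_apply, Fin.sum_univ_three, star_apply]
  have hDE' := (unitary_conj_eq_iff hV).1 hDE
  have f : ∀ i, (star V * D * V) i 0 = 0 := by rw [hDE']; exact hE
  have f0 := f 0
  have f1 := f 1
  simp only [mul_apply, Fin.sum_univ_two, star_apply, hD] at f0 f1
  refine ⟨(star W * C * W) 0 1, (star W * C * W) 1 2, (star W * C * W) 0 2,
    (star W * C * W) 2 2, hBC.trans ⟨W, hW, (unitary_conj_eq_iff hW).2 ?_⟩⟩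
  ext i j
  fin_cases i <;> fin_cases j <;>
    simp_all [mul_apply, Fin.sum_univ_three, star_apply]

end Triangular

/-! ### The equation of the boundary -/

section Coefficients

open Polynomial

/-- The constant and linear coefficients in `u` of `det (2 r u - B - u² Bᴴ)`, a polynomial that
vanishes on the unit circle, hence identically. -/
theorem det_and_minors_eq_zero {B : Matrix (Fin 3) (Fin 3) ℂ} {r : ℝ} (hr : 0 < r)
    (h : ∀ u : ℂ, ‖u‖ = 1 →
      ((2 * r * u) • (1 : Matrix (Fin 3) (Fin 3) ℂ) - B - u ^ 2 • Bᴴ).det = 0) :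
    B.det = 0 ∧ B.trace ^ 2 = (B * B).trace := by
  set P : Matrix (Fin 3) (Fin 3) ℂ[X] :=
    (C (2 * r : ℂ) * X) • 1 - B.map C - (X ^ 2 : ℂ[X]) • Bᴴ.map C with hP
  have hev : ∀ u : ℂ, P.det.eval u
      = ((2 * r * u) • (1 : Matrix (Fin 3) (Fin 3) ℂ) - B - u ^ 2 • Bᴴ).det := by
    intro u
    rw [← coe_evalRingHom, RingHom.map_det]
    congr 1
    ext i j
    fin_cases i <;> fin_cases j <;> simp [hP] <;> ring
  have hinf : Set.Infinite {u : ℂ | ‖u‖ = 1} := by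
    have hS : {u : ℂ | ‖u‖ = 1} = Metric.sphere 0 1 := by ext u; simp
    rw [hS]
    refine (isPreconnected_sphere (by simp) 0 1).infinite_of_nontrivial ⟨1, by simp, -1, by simp, ?_⟩
    norm_num [Complex.ext_iff]
  have hP0 : P.det = 0 := by
    refine Polynomial.eq_zero_of_infinite_isRoot _ (hinf.mono fun u hu => ?_)
    rw [Set.mem_ofPred_eq] at hu
    rw [Set.mem_ofPred_eq, IsRoot.def, hev, h u hu]
  have c0 := congrArg (Polynomial.eval 0) hP0
  have c1 := congrArg (fun p => (derivative p).eval 0) hP0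
  have hr' : (r : ℂ) ≠ 0 := by exact_mod_cast hr.ne'
  constructor
  · rw [hev] at c0
    simpa [det_neg] using c0
  · simp [det_fin_three, hP] at c1
    have : (r : ℂ) * (B.trace ^ 2 - (B * B).trace) = 0 := by
      simp only [trace_fin_three, mul_apply, Fin.sum_univ_three]
      linear_combination c1
    rcases mul_eq_zero.1 this with h | h
    · exact absurd h hr'
    · exact sub_eq_zero.1 h

/-- For the triangular form the polynomial of `det_and_minors_eq_zero` is `u²` times a polynomial
of degree two, which is evaluated at the points `1`, `-1` and `i`. -/
theorem entries_of_upperTriangular {x y z a : ℂ} {r : ℝ} (hr : 0 < r)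
    (h : ∀ u : ℂ, ‖u‖ = 1 → ((2 * r * u) • (1 : Matrix (Fin 3) (Fin 3) ℂ)
      - !![0, x, z; 0, 0, y; 0, 0, a] - u ^ 2 • (!![0, x, z; 0, 0, y; 0, 0, a])ᴴ).det = 0) :
    4 * (r : ℂ) ^ 2 = x * conj x + y * conj y + z * conj z ∧
      a * (y * conj y + z * conj z) = -(x * y * conj z) := by
  have hr' : (r : ℂ) ≠ 0 := by exact_mod_cast hr.ne'
  have key : ∀ u : ℂ, ‖u‖ = 1 →
      (-4 * r ^ 2 * a + x * conj x * a - x * y * conj z)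
      + (8 * r ^ 3 - 2 * r * (x * conj x + y * conj y + z * conj z)) * u
      + (-4 * r ^ 2 * conj a + x * conj x * conj a - conj x * conj y * z) * u ^ 2 = 0 := by
    intro u hu
    have hu0 : u ≠ 0 := by rintro rfl; simp at hu
    have h1 := h u hu
    simp [det_fin_three] at h1
    refine (mul_eq_zero.1 (?_ : u ^ 2 * _ = 0)).resolve_left (pow_ne_zero 2 hu0)
    linear_combination h1
  have k1 := key 1 (by simp)
  have k2 := key (-1) (by simp)
  have k3 := key Complex.I (by simp)
  have hI := Complex.I_sq
  have e1 : 4 * (r : ℂ) ^ 2 = x * conj x + y * conj y + z * conj z := by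
    have : (2 * r : ℂ) * (4 * (r : ℂ) ^ 2 - (x * conj x + y * conj y + z * conj z)) = 0 := by
      linear_combination (k1 - k2) / 2
    rcases mul_eq_zero.1 this with h | h
    · exact absurd h (by simpa using hr')
    · exact sub_eq_zero.1 h
  refine ⟨e1, ?_⟩
  have e2 : 8 * (r : ℂ) ^ 3 - 2 * r * (x * conj x + y * conj y + z * conj z) = 0 := by
    linear_combination (2 * r : ℂ) * e1
  rw [e2, hI] at k3
  rw [e2] at k1
  linear_combination -(k1 + k3) / 2 - a * e1

end Coefficients

end Matrix

/-! ### Maximizing vectors -/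

section MaximizingVectors

variable {E : Type*} [NormedAddCommGroup E] [InnerProductSpace ℂ E]

theorem norm_sub_smul_sq (w v : E) (t : ℂ) :
    ‖w - t • v‖ ^ 2 = ‖w‖ ^ 2 - 2 * (conj t * inner ℂ v w).re + ‖t‖ ^ 2 * ‖v‖ ^ 2 := by
  rw [norm_sub_sq (𝕜 := ℂ), norm_smul, mul_pow, ← inner_re_symm (𝕜 := ℂ), inner_smul_left]
  rfl

theorem ContinuousLinearMap.adjoint_apply_apply_of_norm_eq [CompleteSpace E] (f : E →L[ℂ] E)
    {v : E} (hv : ‖v‖ = 1) (h : ‖f v‖ = ‖f‖) :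
    ContinuousLinearMap.adjoint f (f v) = ((‖f‖ ^ 2 : ℝ) : ℂ) • v := by
  have h1 : ‖ContinuousLinearMap.adjoint f (f v)‖ ≤ ‖f‖ * ‖f‖ := by
    have := (ContinuousLinearMap.adjoint f).le_opNorm (f v)
    rwa [LinearIsometryEquiv.norm_map, h] at this
  have h2 : RCLike.re (inner ℂ (ContinuousLinearMap.adjoint f (f v)) (((‖f‖ ^ 2 : ℝ) : ℂ) • v))
      = ‖f‖ ^ 2 * ‖f‖ ^ 2 := by
    rw [inner_smul_right, ContinuousLinearMap.adjoint_inner_left, inner_self_eq_norm_sq_to_K, h]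
    simp only [Complex.coe_algebraMap, ← Complex.ofReal_pow, ← Complex.ofReal_mul]
    rfl
  have h3 := norm_sub_sq (𝕜 := ℂ) (ContinuousLinearMap.adjoint f (f v)) (((‖f‖ ^ 2 : ℝ) : ℂ) • v)
  rw [h2, norm_smul, hv, Complex.norm_real, Real.norm_of_nonneg (sq_nonneg _)] at h3
  have h4 : ‖ContinuousLinearMap.adjoint f (f v)‖ ^ 2 ≤ (‖f‖ * ‖f‖) ^ 2 := by gcongr
  have h5 : ‖ContinuousLinearMap.adjoint f (f v) - ((‖f‖ ^ 2 : ℝ) : ℂ) • v‖ ^ 2 ≤ 0 := by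
    rw [h3]; nlinarith
  have h6 := pow_eq_zero_iff (two_ne_zero) |>.1 (le_antisymm h5 (sq_nonneg _))
  exact sub_eq_zero.1 (norm_eq_zero.1 h6)

variable [FiniteDimensional ℂ E]

theorem ContinuousLinearMap.exists_norm_apply_eq_opNorm [Nontrivial E] (f : E →L[ℂ] E) :
    ∃ v : E, ‖v‖ = 1 ∧ ‖f v‖ = ‖f‖ := by
  have : ProperSpace E := FiniteDimensional.proper ℂ E
  have hne : (Metric.sphere (0 : E) 1).Nonempty := by
    obtain ⟨x, hx⟩ := exists_norm_eq E zero_le_one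
    exact ⟨x, by simpa using hx⟩
  obtain ⟨v, hv, hmax⟩ := (isCompact_sphere (0 : E) 1).exists_isMaxOn hne
    (f := fun v => ‖f v‖) (by fun_prop)
  have hv1 : ‖v‖ = 1 := by simpa using hv
  refine ⟨v, hv1, le_antisymm (by simpa [hv1] using f.le_opNorm v) ?_⟩
  exact ContinuousLinearMap.opNorm_le_of_unit_norm (norm_nonneg _) fun x hx =>
    hmax (show x ∈ Metric.sphere (0 : E) 1 by simpa using hx)

/-- First-order condition for `0` to minimize `t ↦ ‖f - t‖`: in no direction `u` can all maximizing
vectors `v` of `f` satisfy `0 < re (ū ⟨v, f v⟩)`. -/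
theorem ContinuousLinearMap.exists_norm_apply_eq_and_re_inner_nonpos [Nontrivial E] (f : E →L[ℂ] E)
    (hf : ∀ t : ℂ, ‖f‖ ≤ ‖f - t • (1 : E →L[ℂ] E)‖) (u : ℂ) :
    ∃ v : E, ‖v‖ = 1 ∧ ‖f v‖ = ‖f‖ ∧ (conj u * inner ℂ v (f v)).re ≤ 0 := by
  have : ProperSpace E := FiniteDimensional.proper ℂ E
  set ε : ℕ → ℝ := fun n => 1 / ((n : ℝ) + 1) with hε
  have hpos : ∀ n, 0 < ε n := fun n => Nat.one_div_pos_of_nat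
  -- maximizing vectors of `f - ε u` accumulate at the required vector as `ε → 0`
  have hv : ∀ n, ∃ v : E, ‖v‖ = 1 ∧ ‖f‖ - ε n * ‖u‖ ≤ ‖f v‖ ∧
      (conj u * inner ℂ v (f v)).re ≤ ε n * (‖u‖ ^ 2 / 2) := by
    intro n
    obtain ⟨v, hv, hvn⟩ := (f - ((ε n : ℂ) * u) • (1 : E →L[ℂ] E)).exists_norm_apply_eq_opNorm
    have hle := hf ((ε n : ℂ) * u)
    rw [← hvn] at hle
    have e : (f - ((ε n : ℂ) * u) • (1 : E →L[ℂ] E)) v = f v - ((ε n : ℂ) * u) • v := rfl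
    have hnu : ‖(ε n : ℂ) * u‖ = ε n * ‖u‖ := by
      rw [norm_mul, Complex.norm_real, Real.norm_of_nonneg (hpos n).le]
    rw [e] at hle
    refine ⟨v, hv, ?_, ?_⟩
    · have := norm_sub_le (f v) (((ε n : ℂ) * u) • v)
      rw [norm_smul, hnu, hv] at this
      linarith
    · have h1 := norm_sub_smul_sq (f v) v ((ε n : ℂ) * u)
      have h2 : ‖f‖ ^ 2 ≤ ‖f v - ((ε n : ℂ) * u) • v‖ ^ 2 := by gcongr
      have h3 : ‖f v‖ ^ 2 ≤ ‖f‖ ^ 2 := by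
        have := f.le_opNorm v
        rw [hv, mul_one] at this
        gcongr
      have h4 : (conj ((ε n : ℂ) * u) * inner ℂ v (f v)).re
          = ε n * (conj u * inner ℂ v (f v)).re := by
        rw [map_mul, Complex.conj_ofReal, mul_assoc, Complex.re_ofReal_mul]
      rw [h4, hnu, hv] at h1
      have h5 : ε n * (conj u * inner ℂ v (f v)).re ≤ ε n * (ε n * (‖u‖ ^ 2 / 2)) := by
        nlinarith
      exact le_of_mul_le_mul_left h5 (hpos n)
  choose v hv1 hv2 hv3 using hv
  obtain ⟨w, hw, φ, hφ, hlim⟩ := (isCompact_sphere (0 : E) 1).tendsto_subseq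
    (x := v) (fun n => by simpa using hv1 n)
  have hw1 : ‖w‖ = 1 := by simpa using hw
  have hε0 : Filter.Tendsto (fun n => ε (φ n)) Filter.atTop (nhds 0) :=
    tendsto_one_div_add_atTop_nhds_zero_nat.comp hφ.tendsto_atTop
  refine ⟨w, hw1, le_antisymm (by simpa [hw1] using f.le_opNorm w) ?_, ?_⟩
  · have h1 : Filter.Tendsto (fun n => ‖f‖ - ε (φ n) * ‖u‖) Filter.atTop (nhds (‖f‖ - 0 * ‖u‖)) :=
      (hε0.mul_const _).const_sub _
    have h2 : Filter.Tendsto (fun n => ‖f (v (φ n))‖) Filter.atTop (nhds ‖f w‖) :=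
      ((f.continuous.norm).tendsto w).comp hlim
    simpa using le_of_tendsto_of_tendsto' h1 h2 fun n => hv2 (φ n)
  · have h1 : Filter.Tendsto (fun n => ε (φ n) * (‖u‖ ^ 2 / 2)) Filter.atTop
        (nhds (0 * (‖u‖ ^ 2 / 2))) := hε0.mul_const _
    have hc : Continuous fun v : E => (conj u * inner ℂ v (f v)).re := by fun_prop
    have h2 : Filter.Tendsto (fun n => (conj u * inner ℂ (v (φ n)) (f (v (φ n)))).re) Filter.atTop
        (nhds (conj u * inner ℂ w (f w)).re) := (hc.tendsto w).comp hlim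
    simpa using le_of_tendsto_of_tendsto' h2 h1 fun n => hv3 (φ n)

end MaximizingVectors

namespace Matrix

/-! ### Roberts orthogonality forces both centres to vanish -/

section RobertsCentre

variable {n : Type*} [Fintype n] [DecidableEq n]

theorem isCenterOfMass_zero_of_robertsOrthogonal {A : Matrix n n ℂ}
    (h : RobertsOrthogonal ℂ A (1 : Matrix n n ℂ)) : IsCenterOfMass A 0 := by
  intro μ
  have h1 : (2 : ℂ) • A = (A + μ • (1 : Matrix n n ℂ)) + (A - μ • (1 : Matrix n n ℂ)) := by module
  have h2 := norm_add_le (A + μ • (1 : Matrix n n ℂ)) (A - μ • (1 : Matrix n n ℂ))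
  rw [← h1, norm_smul, h μ] at h2
  simp at h2 ⊢
  linarith

theorem norm_toEuclideanCLM_apply_le (A : Matrix n n ℂ) (x : EuclideanSpace ℂ n) :
    ‖toEuclideanCLM (𝕜 := ℂ) A x‖ ≤ ‖A‖ * ‖x‖ :=
  (toEuclideanCLM (𝕜 := ℂ) A).le_opNorm x

theorem toEuclideanCLM_sub_smul_one_apply (A : Matrix n n ℂ) (t : ℂ) (x : EuclideanSpace ℂ n) :
    toEuclideanCLM (𝕜 := ℂ) (A - t • 1) x = toEuclideanCLM (𝕜 := ℂ) A x - t • x := by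
  rw [map_sub, map_smul, map_one]; rfl

/-- The numerical radius of `A - ν`, whose numerical range is the disk of centre `c - ν`, is
`r + ‖ν - c‖`, and the norm is at least the numerical radius. -/
theorem add_norm_le_norm_sub_of_numRange {A : Matrix n n ℂ} {c : ℂ} {r : ℝ} (hr : 0 ≤ r)
    (hW : numRange A = Metric.closedBall c r) (ν : ℂ) :
    r + ‖ν - c‖ ≤ ‖A - ν • (1 : Matrix n n ℂ)‖ := by
  obtain ⟨u, hu, hνu⟩ : ∃ u : ℂ, ‖u‖ = 1 ∧ ν - c = -(‖ν - c‖ * u) := by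
    rcases eq_or_ne (ν - c) 0 with h | h
    · exact ⟨1, by simp, by simp [h]⟩
    · have h' : (‖ν - c‖ : ℂ) ≠ 0 := by simpa using h
      refine ⟨-((ν - c) / ‖ν - c‖), by simp [h], ?_⟩
      rw [mul_neg, neg_neg, mul_div_cancel₀ _ h']
  obtain ⟨x, hx, hxu⟩ := exists_inner_eq_of_numRange hr hW hu.le
  have e : inner ℂ x (toEuclideanCLM (𝕜 := ℂ) (A - ν • 1) x) = ((r + ‖ν - c‖ : ℝ) : ℂ) * u := by
    rw [inner_toEuclideanCLM_sub_smul_one, hx] at hxu ⊢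
    push_cast at hxu ⊢
    linear_combination hxu - hνu
  have h1 := norm_inner_le_norm (𝕜 := ℂ) x (toEuclideanCLM (𝕜 := ℂ) (A - ν • 1) x)
  have h2 := norm_toEuclideanCLM_apply_le (A - ν • 1) x
  rw [e, norm_mul, hu, Complex.norm_real, Real.norm_of_nonneg (by positivity), hx] at h1
  rw [hx] at h2
  linarith

theorem norm_sub_sq_le_of_numRange {A : Matrix n n ℂ} {c : ℂ} {r : ℝ} (hr : 0 ≤ r)
    (hW : numRange A = Metric.closedBall c r) (ν : ℂ) :
    ‖A - ν • (1 : Matrix n n ℂ)‖ ^ 2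
      ≤ ‖A - c • (1 : Matrix n n ℂ)‖ ^ 2 + 2 * r * ‖ν - c‖ + ‖ν - c‖ ^ 2 := by
  rw [← Real.le_sqrt (norm_nonneg _) (by positivity), l2_opNorm_def]
  refine ContinuousLinearMap.opNorm_le_of_unit_norm (Real.sqrt_nonneg _) fun x hx => ?_
  change ‖toEuclideanCLM (𝕜 := ℂ) (A - ν • 1) x‖ ≤ _
  apply Real.le_sqrt_of_sq_le
  have e : A - ν • (1 : Matrix n n ℂ) = (A - c • 1) - (ν - c) • 1 := by module
  rw [e, toEuclideanCLM_sub_smul_one_apply, norm_sub_smul_sq, hx]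
  have h1 := norm_inner_le_of_numRange hW x
  have h2 := norm_toEuclideanCLM_apply_le (A - c • 1) x
  rw [hx] at h1 h2
  have h3 := (abs_le.1 (Complex.abs_re_le_norm
    (conj (ν - c) * inner ℂ x (toEuclideanCLM (𝕜 := ℂ) (A - c • 1) x)))).1
  rw [norm_mul, RCLike.norm_conj] at h3
  have h4 := mul_le_mul_of_nonneg_left h1 (norm_nonneg (ν - c))
  have h5 : ‖toEuclideanCLM (𝕜 := ℂ) (A - c • 1) x‖ ^ 2 ≤ ‖A - c • (1 : Matrix n n ℂ)‖ ^ 2 := by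
    rw [mul_one] at h2; gcongr
  nlinarith

/-- As `ν → ∞`, `‖A - ν‖ = r + ‖ν - c‖ + o(1)`, so the norm sees the centre of the disk. -/
theorem center_eq_zero_of_robertsOrthogonal {A : Matrix n n ℂ} {c : ℂ} {r : ℝ} (hr : 0 ≤ r)
    (hW : numRange A = Metric.closedBall c r) (h : RobertsOrthogonal ℂ A (1 : Matrix n n ℂ)) :
    c = 0 := by
  by_contra hc
  have hc' : 0 < ‖c‖ := norm_pos_iff.2 hc
  set K := ‖A - c • (1 : Matrix n n ℂ)‖ ^ 2 with hK
  have hK0 : 0 ≤ K := sq_nonneg _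
  -- the two bounds on the norm at `-t c` and `t c` give `4 t |c|² ≤ K`, which this `t` violates
  set t : ℝ := 1 + K / ‖c‖ ^ 2 with ht
  have ht1 : 1 ≤ t := by rw [ht]; linarith [div_nonneg hK0 (sq_nonneg ‖c‖)]
  have htc : t * ‖c‖ ^ 2 = ‖c‖ ^ 2 + K := by rw [ht]; field_simp
  have h1 := add_norm_le_norm_sub_of_numRange hr hW (-(t * c))
  have h2 := norm_sub_sq_le_of_numRange hr hW (t * c)
  have e1 : ‖-((t : ℂ) * c) - c‖ = (t + 1) * ‖c‖ := by
    rw [show -((t : ℂ) * c) - c = -(((t + 1 : ℝ) : ℂ) * c) by push_cast; ring, norm_neg, norm_mul,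
      Complex.norm_real, Real.norm_of_nonneg (by linarith)]
  have e2 : ‖(t : ℂ) * c - c‖ = (t - 1) * ‖c‖ := by
    rw [show (t : ℂ) * c - c = ((t - 1 : ℝ) : ℂ) * c by push_cast; ring, norm_mul,
      Complex.norm_real, Real.norm_of_nonneg (by linarith)]
  rw [neg_smul, sub_neg_eq_add, h, e1] at h1
  rw [e2, ← hK] at h2
  have h3 : (r + (t + 1) * ‖c‖) ^ 2 ≤ ‖A - ((t : ℂ) * c) • (1 : Matrix n n ℂ)‖ ^ 2 :=
    pow_le_pow_left₀ (by positivity) h1 2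
  have h4 : 0 < ‖c‖ ^ 2 := by positivity
  have h5 : 0 ≤ r * ‖c‖ := by positivity
  nlinarith

end RobertsCentre

/-! ### The Stampfli point of the triangular form -/

section StampfliPoint

/-- Maximizing vectors of a matrix are eigenvectors of `Mᴴ M`. -/
theorem conjTranspose_mulVec_mulVec_of_norm_eq {n : Type*} [Fintype n] [DecidableEq n]
    (M : Matrix n n ℂ) {v : EuclideanSpace ℂ n} (hv : ‖v‖ = 1)
    (h : ‖toEuclideanCLM (𝕜 := ℂ) M v‖ = ‖M‖) :
    Mᴴ *ᵥ (M *ᵥ WithLp.ofLp v) = ((‖M‖ ^ 2 : ℝ) : ℂ) • WithLp.ofLp v := by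
  have h1 := (toEuclideanCLM (𝕜 := ℂ) M).adjoint_apply_apply_of_norm_eq hv h
  rw [← ContinuousLinearMap.star_eq_adjoint, ← map_star] at h1
  exact congrArg WithLp.ofLp h1

/-- If `0` minimizes `‖M - μ‖` for the triangular form `M` of a matrix whose numerical range is a
disk centred at `0`, then `M` is nilpotent or splits off its last diagonal entry. Otherwise
`x, y, z ≠ 0`, all maximizing vectors of `M` are proportional to a single one, `v = (0, k, 1)`, and
minimality forces `⟨v, M v⟩ = 0`, which contradicts the eigenvector equations of `v`. -/
theorem eq_zero_or_of_isCenterOfMass {x y z a : ℂ}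
    (ha : a * (y * conj y + z * conj z) = -(x * y * conj z))
    (hM : IsCenterOfMass !![0, x, z; 0, 0, y; 0, 0, a] 0) : a = 0 ∨ (y = 0 ∧ z = 0) := by
  by_contra! hcon
  obtain ⟨ha0, hyz⟩ := hcon
  set M : Matrix (Fin 3) (Fin 3) ℂ := !![0, x, z; 0, 0, y; 0, 0, a] with hMdef
  have hNr : y * conj y + z * conj z = ((‖y‖ ^ 2 + ‖z‖ ^ 2 : ℝ) : ℂ) := by
    rw [Complex.mul_conj, Complex.mul_conj, Complex.normSq_eq_norm_sq, Complex.normSq_eq_norm_sq]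
    push_cast; rfl
  have hN : y * conj y + z * conj z ≠ 0 := by
    rw [hNr, Complex.ofReal_ne_zero]
    intro h
    have h1 : ‖y‖ ^ 2 = 0 := by nlinarith [sq_nonneg ‖y‖, sq_nonneg ‖z‖]
    have h2 : ‖z‖ ^ 2 = 0 := by nlinarith [sq_nonneg ‖y‖, sq_nonneg ‖z‖]
    exact hyz (by simpa using h1) (by simpa using h2)
  have hxyz : x * y * conj z ≠ 0 := by
    intro h
    rw [h, neg_zero] at ha
    exact (mul_ne_zero ha0 hN) ha
  have hx : x ≠ 0 := by rintro rfl; simp at hxyz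
  have hy : y ≠ 0 := by rintro rfl; simp at hxyz
  have hz : z ≠ 0 := by rintro rfl; simp at hxyz
  have hcx : conj x ≠ 0 := by simpa using hx
  have hcy : conj y ≠ 0 := by simpa using hy
  have hM0 : M ≠ 0 := by
    intro h
    exact hx (by simpa [hMdef] using congrFun (congrFun h 0) 1)
  set s : ℂ := ((‖M‖ ^ 2 : ℝ) : ℂ) with hs
  have hs0 : s ≠ 0 := by simpa [hs] using hM0
  -- the shape of an arbitrary maximizing vector
  have hmax : ∀ v : EuclideanSpace ℂ (Fin 3), ‖v‖ = 1 → ‖toEuclideanCLM (𝕜 := ℂ) M v‖ = ‖M‖ →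
      v 0 = 0 ∧ v 2 ≠ 0 ∧ v 1 * (s - x * conj x) = conj x * z * v 2 ∧
      s * v 2 = conj z * (x * v 1 + z * v 2) + (y * conj y + a * conj a) * v 2 := by
    intro v hv hvM
    have h := conjTranspose_mulVec_mulVec_of_norm_eq M hv hvM
    rw [← hs] at h
    have h0 := congrFun h 0
    have h1 := congrFun h 1
    have h2 := congrFun h 2
    simp [hMdef, mulVec, dotProduct, Fin.sum_univ_three] at h0 h1 h2
    have hv0 : v 0 = 0 := h0.resolve_left hs0
    have e1 : v 1 * (s - x * conj x) = conj x * z * v 2 := by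
      linear_combination -h1
    have e2 : s * v 2 = conj z * (x * v 1 + z * v 2) + (y * conj y + a * conj a) * v 2 := by
      linear_combination -h2
    refine ⟨hv0, fun hv2 => ?_, e1, e2⟩
    rw [hv2] at e2
    have hv1 : v 1 = 0 := by
      have : conj z * x * v 1 = 0 := by linear_combination -e2
      simpa [hz, hx] using this
    have : v = 0 := by
      ext i; fin_cases i <;> simp [hv0, hv1, hv2]
    rw [this] at hv
    simp at hv
  have hmin : ∀ t : ℂ, ‖toEuclideanCLM (𝕜 := ℂ) M‖
      ≤ ‖toEuclideanCLM (𝕜 := ℂ) M - t • (1 : EuclideanSpace ℂ (Fin 3) →L[ℂ] _)‖ := by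
    intro t
    have := hM t
    rw [zero_smul, sub_zero, ← l2_opNorm_toEuclideanCLM, ← l2_opNorm_toEuclideanCLM, map_sub,
      map_smul, map_one] at this
    exact this
  have hexists := (toEuclideanCLM (𝕜 := ℂ) M).exists_norm_apply_eq_and_re_inner_nonpos hmin
  obtain ⟨v₀, hv₀, hv₀M, -⟩ := hexists 0
  obtain ⟨-, h2, h3, -⟩ := hmax v₀ hv₀ hv₀M
  have hsx : s - x * conj x ≠ 0 := by
    intro h
    rw [h, mul_zero] at h3
    exact mul_ne_zero (mul_ne_zero hcx hz) h2 h3.symm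
  set k : ℂ := conj x * z / (s - x * conj x) with hk
  have hks : k * (s - x * conj x) = conj x * z := div_mul_cancel₀ _ hsx
  -- `v = v 2 • (0, k, 1)`, so `⟨v, M v⟩` is a positive multiple of `q = y k̄ + a`; test with `u = q`
  obtain ⟨v, hv, hvM, hre⟩ := hexists (y * conj k + a)
  obtain ⟨h1, h2, h3, h4⟩ := hmax v hv hvM
  have hvk : v 1 = k * v 2 := by
    apply mul_right_cancel₀ hsx
    rw [h3]; linear_combination -(v 2) * hks
  have hinner : inner ℂ v (toEuclideanCLM (𝕜 := ℂ) M v)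
      = (y * conj k + a) * ((‖v 2‖ ^ 2 : ℝ) : ℂ) := by
    rw [← star_dotProduct_mulVec_eq_inner]
    have := Complex.mul_conj (v 2)
    rw [Complex.normSq_eq_norm_sq] at this
    rw [← this]
    simp [hMdef, mulVec, dotProduct, Fin.sum_univ_three, h1, hvk]
    ring
  have hq : y * conj k + a = 0 := by
    by_contra hq
    rw [hinner, ← mul_assoc, mul_comm (conj _), Complex.mul_conj, ← Complex.ofReal_mul,
      Complex.ofReal_re] at hre
    have : 0 < Complex.normSq (y * conj k + a) * ‖v 2‖ ^ 2 :=
      mul_pos (Complex.normSq_pos.2 hq) (pow_pos (norm_pos_iff.2 h2) 2)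
    linarith
  -- hence `k = x̄ z / N` and `s = |x|² + N` with `N = |y|² + |z|²`
  have hca := congrArg conj ha
  simp only [map_mul, map_add, map_neg, Complex.conj_conj] at hca
  have hcq := congrArg conj hq
  simp only [map_mul, map_add, map_zero, Complex.conj_conj] at hcq
  have hkN : k * (y * conj y + z * conj z) = conj x * z := by
    apply mul_left_cancel₀ hcy
    linear_combination (y * conj y + z * conj z) * hcq - hca
  have hsN : s - x * conj x = y * conj y + z * conj z := by
    have hk0 : k ≠ 0 := by
      intro h
      rw [h, zero_mul] at hks
      exact mul_ne_zero hcx hz hks.symm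
    apply mul_left_cancel₀ hk0
    rw [hks, hkN]
  have h5 : s = conj z * (x * k + z) + y * conj y + a * conj a := by
    apply mul_right_cancel₀ h2
    rw [h4, hvk]; ring
  set Y := y * conj y with hY
  set Z := z * conj z with hZ
  set X := x * conj x with hX
  have h6 : X * (Y + Z) ^ 2 = X * Z * (Y + Z) + X * Y * Z := by
    have haa : a * conj a * (Y + Z) ^ 2 = X * Y * Z := by
      calc a * conj a * (Y + Z) ^ 2 = (a * (Y + Z)) * (conj a * (Y + Z)) := by ring
        _ = X * Y * Z := by
          rw [ha, show conj a * (Y + Z) = -(conj x * conj y * z) by rw [← hca]; ring, hX, hY, hZ]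
          ring
    have hkk : conj z * x * k * (Y + Z) = X * Z := by
      rw [hX, hZ]; linear_combination (conj z * x) * hkN
    linear_combination (Y + Z) ^ 2 * h5 - (Y + Z) ^ 2 * hsN + haa + (Y + Z) * hkk
  have h7 : X * Y * Y = 0 := by linear_combination h6
  simp [hX, hY, hx, hy] at h7

end StampfliPoint

/-! ### The block form -/

section BlockForm

theorem dirSum_one_two (P : Matrix (Fin 1) (Fin 1) ℂ) (Q : Matrix (Fin 2) (Fin 2) ℂ) :
    (dirSum P Q : Matrix (Fin 3) (Fin 3) ℂ)
      = !![P 0 0, 0, 0; 0, Q 0 0, Q 0 1; 0, Q 1 0, Q 1 1] := by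
  ext i j
  fin_cases i <;> fin_cases j <;> rfl

/-- `A` is nilpotent, or unitarily similar to the direct sum of a `1 × 1` block and a nilpotent
`2 × 2` block. -/
def IsNilpotentOrBlock (A : Matrix (Fin 3) (Fin 3) ℂ) : Prop :=
  IsNilpotent A ∨ ∃ (P : Matrix (Fin 1) (Fin 1) ℂ) (Q : Matrix (Fin 2) (Fin 2) ℂ),
    IsNilpotent Q ∧ UnitarilySimilar A (dirSum P Q)

theorem UnitarilySimilar.isNilpotentOrBlock {A B : Matrix (Fin 3) (Fin 3) ℂ}
    (h : UnitarilySimilar A B) (hB : IsNilpotentOrBlock B) : IsNilpotentOrBlock A := by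
  rcases hB with hB | ⟨P, Q, hQ, hB⟩
  · exact Or.inl (h.isNilpotent_iff.2 hB)
  · exact Or.inr ⟨P, Q, hQ, h.trans hB⟩

theorem isNilpotentOrBlock_of_upperTriangular {x y z a : ℂ} (h : a = 0 ∨ (y = 0 ∧ z = 0)) :
    IsNilpotentOrBlock !![0, x, z; 0, 0, y; 0, 0, a] := by
  rcases h with rfl | ⟨rfl, rfl⟩
  · refine Or.inl ⟨3, ?_⟩
    ext i j
    fin_cases i <;> fin_cases j <;> simp [pow_succ]
  · refine Or.inr ⟨!![a], !![0, x; 0, 0], ⟨2, ?_⟩, !![0, 1, 0; 0, 0, 1; 1, 0, 0], ?_, ?_⟩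
    · ext i j
      fin_cases i <;> fin_cases j <;> simp [pow_succ]
    · rw [mem_unitaryGroup_iff]
      ext i j
      fin_cases i <;> fin_cases j <;> simp [mul_apply, Fin.sum_univ_three]
    · rw [dirSum_one_two]
      ext i j
      fin_cases i <;> fin_cases j <;> simp [mul_apply, Fin.sum_univ_three]

theorem det_eq_zero_of_isNilpotent {n : Type*} [Fintype n] [DecidableEq n] [Nonempty n]
    {A : Matrix n n ℂ} (h : IsNilpotent A) : A.det = 0 := by
  obtain ⟨k, hk⟩ := h
  have : A.det ^ k = 0 := by rw [← det_pow, hk, det_zero]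
  exact eq_zero_of_pow_eq_zero this

theorem UnitarilySimilar.trace_eq {n : Type*} [Fintype n] [DecidableEq n] {A B : Matrix n n ℂ}
    (h : UnitarilySimilar A B) : A.trace = B.trace := by
  obtain ⟨U, hU, rfl⟩ := h
  exact trace_unitary_conj hU B

theorem UnitarilySimilar.det_eq {n : Type*} [Fintype n] [DecidableEq n] {A B : Matrix n n ℂ}
    (h : UnitarilySimilar A B) : A.det = B.det := by
  obtain ⟨U, hU, rfl⟩ := h
  exact det_unitary_conj hU B

theorem UnitarilySimilar.mul_self {n : Type*} [Fintype n] [DecidableEq n] {A B : Matrix n n ℂ}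
    (h : UnitarilySimilar A B) : UnitarilySimilar (A * A) (B * B) := by
  obtain ⟨U, hU, rfl⟩ := h
  exact ⟨U, hU, unitary_conj_mul hU B B⟩

/-- The eigenvalues of `A` are `p, 0, 0` for some `p`, so `tr(A)² = p² = tr(A²)`. -/
theorem IsNilpotentOrBlock.det_and_trace {A : Matrix (Fin 3) (Fin 3) ℂ}
    (h : IsNilpotentOrBlock A) : A.det = 0 ∧ A.trace ^ 2 = (A * A).trace := by
  rcases h with h | ⟨P, Q, hQ, h⟩
  · have h2 : IsNilpotent (A * A) := (Commute.refl A).isNilpotent_mul_right h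
    refine ⟨?_, ?_⟩
    · exact det_eq_zero_of_isNilpotent h
    · rw [(isNilpotent_trace_of_isNilpotent h).eq_zero,
        (isNilpotent_trace_of_isNilpotent h2).eq_zero]
      simp
  · have hd := det_eq_zero_of_isNilpotent hQ
    have ht := (isNilpotent_trace_of_isNilpotent hQ).eq_zero
    rw [det_fin_two] at hd
    rw [trace_fin_two] at ht
    have h1 := h.trace_eq
    have h2 := h.mul_self.trace_eq
    have h3 := h.det_eq
    rw [h1, h2, h3]
    erw [dirSum_one_two]
    simp only [det_fin_three, trace_fin_three, mul_apply, Fin.sum_univ_three]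
    simp
    constructor
    · linear_combination (P 0 0) * hd
    · linear_combination 2 * (P 0 0) * ht + 2 * hd

theorem UnitarilySimilar.add_smul_one {n : Type*} [Fintype n] [DecidableEq n]
    {A B : Matrix n n ℂ} (h : UnitarilySimilar A B) (t : ℂ) :
    UnitarilySimilar (A + t • 1) (B + t • 1) := by
  obtain ⟨U, hU, rfl⟩ := h
  exact ⟨U, hU, (unitary_conj_add_smul_one hU B t).symm⟩

/-- The eigenvalues of `A` are `c, c, c + a` and, up to order, `p, 0, 0`. -/
theorem IsNilpotentOrBlock.center_eq_zero {A : Matrix (Fin 3) (Fin 3) ℂ}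
    (h : IsNilpotentOrBlock A) {x y z a c : ℂ}
    (hA : UnitarilySimilar (A - c • 1) !![0, x, z; 0, 0, y; 0, 0, a]) : c = 0 := by
  have hA' := hA.add_smul_one c
  rw [sub_add_cancel] at hA'
  obtain ⟨h1, h2⟩ := h.det_and_trace
  rw [hA'.det_eq] at h1
  rw [hA'.trace_eq, hA'.mul_self.trace_eq] at h2
  simp [det_fin_three, trace_fin_three, mul_apply, Fin.sum_univ_three] at h1 h2
  by_contra hc
  have ha : a + c = 0 := by simpa [hc] using h1
  have : c ^ 2 = 0 := by linear_combination h2 / 2 - (2 * c) * ha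
  exact hc (by simpa using this)

/-- An eigenvector of the `1 × 1` block reduces `A`; in triangular coordinates it must be the last
basis vector. -/
theorem eq_zero_of_unitarilySimilar_dirSum {x y z a : ℂ} (ha : a ≠ 0)
    {P : Matrix (Fin 1) (Fin 1) ℂ} {Q : Matrix (Fin 2) (Fin 2) ℂ} (hQ : IsNilpotent Q)
    (h : UnitarilySimilar !![0, x, z; 0, 0, y; 0, 0, a] (dirSum P Q)) : y = 0 ∧ z = 0 := by
  have htr := h.trace_eq
  have ht := (isNilpotent_trace_of_isNilpotent hQ).eq_zero
  rw [trace_fin_two] at ht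
  obtain ⟨U, hU, h⟩ := h
  set T : Matrix (Fin 3) (Fin 3) ℂ := !![0, x, z; 0, 0, y; 0, 0, a] with hT
  set S : Matrix (Fin 3) (Fin 3) ℂ := dirSum P Q with hS
  have hS' := dirSum_one_two P Q
  rw [← hS] at hS'
  have hU' := mem_unitaryGroup_iff'.1 hU
  have hpa : P 0 0 = a := by
    rw [trace_fin_three, trace_fin_three, hS'] at htr
    simp [hT] at htr
    linear_combination -htr - ht
  have h1 : T * U = U * S := by
    rw [h, mul_assoc, hU', mul_one]
  have h2 : star T * U = U * star S := by
    rw [h, star_mul, star_mul, star_star, mul_assoc, mul_assoc, hU', mul_one]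
  have f : ∀ i, (T * U) i 0 = (U * S) i 0 := fun i => by rw [h1]
  have g : ∀ i, (star T * U) i 0 = (U * star S) i 0 := fun i => by rw [h2]
  rw [hS', hpa] at f g
  have f0 := f 0
  have f1 := f 1
  have g0 := g 0
  have g1 := g 1
  simp [hT, mul_apply, Fin.sum_univ_three] at f0 f1 g0 g1
  have u0 : U 0 0 = 0 := by simpa [ha] using g0
  have u1 : U 1 0 = 0 := by simpa [ha, u0] using g1
  have u2 : U 2 0 ≠ 0 := by
    intro u2
    have := congrFun (congrFun hU' 0) 0
    simp [mul_apply, Fin.sum_univ_three, u0, u1, u2] at this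
  simp [u0, u1, u2] at f0 f1
  exact ⟨f1, f0⟩

end BlockForm

/-! ### Roberts orthogonality of the two forms -/

section Symmetry

/-- A matrix unitarily similar to its negative is Roberts orthogonal to the identity. -/
theorem robertsOrthogonal_of_unitarilySimilar_neg {n : Type*} [Fintype n] [DecidableEq n]
    {A : Matrix n n ℂ} (h : UnitarilySimilar A (-A)) :
    RobertsOrthogonal ℂ A (1 : Matrix n n ℂ) := by
  intro ν
  rw [h.norm_add_smul_one, ← norm_neg]
  congr 1
  abel

/-- If one of the three off-diagonal entries vanishes, then a diagonal matrix of signs conjugates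
the strictly triangular matrix to its negative. -/
theorem robertsOrthogonal_of_strictUpperTriangular {x y z : ℂ} (h : x = 0 ∨ y = 0 ∨ z = 0) :
    RobertsOrthogonal ℂ !![0, x, z; 0, 0, y; 0, 0, 0] (1 : Matrix (Fin 3) (Fin 3) ℂ) := by
  have hD : ∀ d : Fin 3 → ℂ, (∀ i, d i * conj (d i) = 1) →
      diagonal d ∈ unitaryGroup (Fin 3) ℂ := by
    intro d hd
    rw [mem_unitaryGroup_iff, star_eq_conjTranspose, diagonal_conjTranspose, diagonal_mul_diagonal,
      ← diagonal_one]
    congr 1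
    ext i
    exact hd i
  apply robertsOrthogonal_of_unitarilySimilar_neg
  rcases h with rfl | rfl | rfl
  · refine ⟨diagonal ![1, 1, -1], hD _ (fun i => by fin_cases i <;> simp), ?_⟩
    ext i j
    fin_cases i <;> fin_cases j <;>
      simp [star_eq_conjTranspose, mul_apply, Fin.sum_univ_three, diagonal]
  · refine ⟨diagonal ![1, -1, -1], hD _ (fun i => by fin_cases i <;> simp), ?_⟩
    ext i j
    fin_cases i <;> fin_cases j <;>
      simp [star_eq_conjTranspose, mul_apply, Fin.sum_univ_three, diagonal]
  · refine ⟨diagonal ![1, -1, 1], hD _ (fun i => by fin_cases i <;> simp), ?_⟩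
    ext i j
    fin_cases i <;> fin_cases j <;>
      simp [star_eq_conjTranspose, mul_apply, Fin.sum_univ_three, diagonal]

/-- The last diagonal entry never contributes to the norm, and the `2 × 2` block is unitarily
similar to its negative. -/
theorem robertsOrthogonal_of_block {x a : ℂ}
    (h : ∀ ν : ℂ, ‖a‖ + ‖ν‖ ≤ ‖!![0, x, 0; 0, 0, 0; 0, 0, a]
      - ν • (1 : Matrix (Fin 3) (Fin 3) ℂ)‖) :
    RobertsOrthogonal ℂ !![0, x, 0; 0, 0, 0; 0, 0, a] (1 : Matrix (Fin 3) (Fin 3) ℂ) := by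
  set T : Matrix (Fin 3) (Fin 3) ℂ := !![0, x, 0; 0, 0, 0; 0, 0, a] with hT
  have key : ∀ ν : ℂ, ‖T - (-ν) • (1 : Matrix (Fin 3) (Fin 3) ℂ)‖
      ≤ ‖T - ν • (1 : Matrix (Fin 3) (Fin 3) ℂ)‖ := by
    intro ν
    set M := ‖T - ν • (1 : Matrix (Fin 3) (Fin 3) ℂ)‖ with hM
    rw [l2_opNorm_def]
    refine ContinuousLinearMap.opNorm_le_bound _ (norm_nonneg _) fun v => ?_
    change ‖toEuclideanCLM (𝕜 := ℂ) (T - (-ν) • 1) v‖ ≤ _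
    -- changing the sign of the second coordinate exchanges `ν` and `-ν` in the `2 × 2` block
    have hw := norm_toEuclideanCLM_apply_le (T - ν • 1) (WithLp.toLp 2 ![v 0, -v 1, 0])
    rw [toEuclideanCLM_sub_smul_one_apply, ← hM] at hw
    rw [toEuclideanCLM_sub_smul_one_apply]
    have hw2 := pow_le_pow_left₀ (norm_nonneg _) hw 2
    refine pow_le_pow_iff_left₀ (norm_nonneg _) (by positivity) two_ne_zero |>.1 ?_
    rw [mul_pow, EuclideanSpace.norm_sq_eq, EuclideanSpace.norm_sq_eq] at hw2 ⊢
    have ha : ‖a * v 2 + ν * v 2‖ ^ 2 ≤ M ^ 2 * ‖v 2‖ ^ 2 := by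
      rw [← add_mul, norm_mul, mul_pow]
      gcongr
      exact (norm_add_le _ _).trans (h ν)
    have e1 : ‖-(v 1 * x) - ν * v 0‖ = ‖x * v 1 + ν * v 0‖ := by rw [← norm_neg]; congr 1; ring
    simp [Fin.sum_univ_three, hT, mulVec, dotProduct] at hw2 ⊢
    rw [e1] at hw2
    nlinarith
  intro ν
  have h1 := key ν
  have h2 := key (-ν)
  rw [neg_neg] at h2
  rw [neg_smul, sub_neg_eq_add] at h1 h2
  exact le_antisymm h1 h2

end Symmetry

/-! ### The characterization -/

section Characterization

variable {A : Matrix (Fin 3) (Fin 3) ℂ} {c : ℂ} {r : ℝ}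

theorem eq_smul_one_of_numRange_eq_singleton (hW : numRange A = Metric.closedBall c 0) :
    A - c • 1 = 0 := by
  set f := toEuclideanCLM (n := Fin 3) (𝕜 := ℂ) (A - c • 1) with hf
  have h : ∀ x : EuclideanSpace ℂ (Fin 3), inner ℂ (f.toLinearMap x) x = 0 := by
    intro x
    have hx := norm_inner_le_of_numRange hW x
    rw [zero_mul, norm_le_zero_iff] at hx
    rw [← inner_conj_symm, map_eq_zero]
    exact hx
  have h0 : f.toLinearMap = 0 := (inner_map_self_eq_zero f.toLinearMap).1 h
  have h1 : f = 0 := ContinuousLinearMap.coe_injective h0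
  exact (map_eq_zero_iff _ (toEuclideanCLM (n := Fin 3) (𝕜 := ℂ)).injective).1 h1

/-- The canonical form of a `3 × 3` matrix whose numerical range is a nondegenerate disk: the
centre is a double eigenvalue. -/
theorem exists_triangular_form_of_numRange (hr : 0 < r)
    (hW : numRange A = Metric.closedBall c r) :
    ∃ x y z a : ℂ, UnitarilySimilar (A - c • 1) !![0, x, z; 0, 0, y; 0, 0, a] ∧
      a * (y * conj y + z * conj z) = -(x * y * conj z) := by
  have hdet := fun (u : ℂ) hu => det_eq_zero_of_numRange hr.le hW (u := u) hu
  obtain ⟨h0, h1⟩ := det_and_minors_eq_zero hr hdet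
  obtain ⟨x, y, z, a, h⟩ := exists_unitarilySimilar_upperTriangular h0 h1
  refine ⟨x, y, z, a, h, (entries_of_upperTriangular hr fun u hu => ?_).2⟩
  obtain ⟨U, hU, h⟩ := h
  rw [← det_unitary_conj hU]
  refine Eq.trans (congrArg det ?_) (hdet u hu)
  have hUU := mem_unitaryGroup_iff.1 hU
  simp only [h, mul_sub, sub_mul, mul_smul_comm, smul_mul_assoc, mul_one, hUU,
    ← star_eq_conjTranspose, star_mul, star_star, mul_assoc]

theorem isNilpotentOrBlock_of_isCenterOfMass (hr : 0 < r)
    (hW : numRange A = Metric.closedBall 0 r) (h : IsCenterOfMass A 0) :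
    IsNilpotentOrBlock A := by
  obtain ⟨x, y, z, a, hA, ha⟩ := exists_triangular_form_of_numRange hr hW
  rw [zero_smul, sub_zero] at hA
  exact hA.isNilpotentOrBlock (isNilpotentOrBlock_of_upperTriangular
    (eq_zero_or_of_isCenterOfMass ha ((hA.isCenterOfMass_iff 0).1 h)))

theorem IsNilpotentOrBlock.robertsOrthogonal (h : IsNilpotentOrBlock A) (hr : 0 < r)
    (hW : numRange A = Metric.closedBall c r) :
    RobertsOrthogonal ℂ A (1 : Matrix (Fin 3) (Fin 3) ℂ) := by
  obtain ⟨x, y, z, a, hA, ha⟩ := exists_triangular_form_of_numRange hr hW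
  obtain rfl : c = 0 := h.center_eq_zero hA
  rw [zero_smul, sub_zero] at hA
  rw [hA.robertsOrthogonal_iff]
  rcases eq_or_ne a 0 with rfl | ha0
  · apply robertsOrthogonal_of_strictUpperTriangular
    have : x * y * conj z = 0 := by linear_combination ha
    simpa [or_assoc] using this
  · rcases h with h | ⟨P, Q, hQ, h⟩
    · have := (isNilpotent_trace_of_isNilpotent (hA.isNilpotent_iff.1 h)).eq_zero
      rw [trace_fin_three] at this
      exact absurd (by simpa using this) ha0
    · obtain ⟨rfl, rfl⟩ := eq_zero_of_unitarilySimilar_dirSum ha0 hQ (hA.symm.trans h)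
      apply robertsOrthogonal_of_block
      intro ν
      rw [← hA.norm_sub_smul_one]
      have h1 := add_norm_le_norm_sub_of_numRange hr.le hW ν
      rw [sub_zero] at h1
      -- the eigenvalue `a` lies in the numerical range
      have har : ‖a‖ ≤ r := by
        have hdet : (A + (-a) • 1).det = 0 := by
          rw [(hA.add_smul_one (-a)).det_eq]
          simp [det_fin_three]
        obtain ⟨v, hv, hAv⟩ := exists_mulVec_eq_zero_iff.2 hdet
        rw [add_mulVec, smul_mulVec, one_mulVec, neg_smul, ← sub_eq_add_neg, sub_eq_zero] at hAv
        have h2 := norm_inner_le_of_numRange hW (WithLp.toLp 2 v)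
        have h3 : toEuclideanCLM (𝕜 := ℂ) A (WithLp.toLp 2 v) = a • WithLp.toLp 2 v := by
          rw [toEuclideanCLM_toLp, hAv]; rfl
        rw [zero_smul, sub_zero, h3, inner_smul_right, inner_self_eq_norm_sq_to_K, norm_mul] at h2
        have hv' : WithLp.toLp 2 v ≠ (0 : EuclideanSpace ℂ (Fin 3)) := by simpa using hv
        have h4 : 0 < ‖(WithLp.toLp 2 v : EuclideanSpace ℂ (Fin 3))‖ ^ 2 :=
          pow_pos (norm_pos_iff.2 hv') 2
        refine le_of_mul_le_mul_right ?_ h4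
        simpa using h2
      linarith

end Characterization

end Matrix

theorem mainTheorem10 (A : Matrix (Fin 3) (Fin 3) ℂ) (c : ℂ) (r : ℝ) (hr : 0 ≤ r)
    (hW : Matrix.numRange A = Metric.closedBall c r) :
    (RobertsOrthogonal ℂ A (1 : Matrix (Fin 3) (Fin 3) ℂ) ↔
      (IsNilpotent A ∨
        ∃ (P : Matrix (Fin 1) (Fin 1) ℂ) (Q : Matrix (Fin 2) (Fin 2) ℂ),
          IsNilpotent Q ∧ Matrix.UnitarilySimilar A (Matrix.dirSum P Q))) ∧
    (RobertsOrthogonal ℂ A (1 : Matrix (Fin 3) (Fin 3) ℂ) ↔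
      (c = 0 ∧ Matrix.stampfliPoint A = 0)) := by
  have h1 : RobertsOrthogonal ℂ A (1 : Matrix (Fin 3) (Fin 3) ℂ) →
      c = 0 ∧ Matrix.stampfliPoint A = 0 := fun h =>
    ⟨Matrix.center_eq_zero_of_robertsOrthogonal hr hW h,
      (Matrix.stampfliPoint_eq_iff A 0).2 (Matrix.isCenterOfMass_zero_of_robertsOrthogonal h)⟩
  have h2 : c = 0 ∧ Matrix.stampfliPoint A = 0 → Matrix.IsNilpotentOrBlock A := by
    rintro ⟨rfl, h⟩
    rcases hr.eq_or_lt with rfl | hr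
    · have h0 := Matrix.eq_smul_one_of_numRange_eq_singleton hW
      rw [zero_smul, sub_zero] at h0
      exact Or.inl (h0 ▸ IsNilpotent.zero)
    · exact Matrix.isNilpotentOrBlock_of_isCenterOfMass hr hW
        ((Matrix.stampfliPoint_eq_iff A 0).1 h)
  have h3 : Matrix.IsNilpotentOrBlock A →
      RobertsOrthogonal ℂ A (1 : Matrix (Fin 3) (Fin 3) ℂ) := by
    intro h
    rcases hr.eq_or_lt with rfl | hr
    · have h0 := sub_eq_zero.1 (Matrix.eq_smul_one_of_numRange_eq_singleton hW)
      have hd := h.det_and_trace.1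
      rw [h0, Matrix.det_smul, Matrix.det_one, mul_one] at hd
      have hc : c = 0 := by simpa using hd
      rw [h0, hc]
      intro ν
      simp
    · exact h.robertsOrthogonal hr hW
  exact ⟨⟨fun h => h2 (h1 h), h3⟩, ⟨h1, fun h => h3 (h2 h)⟩⟩
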